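/- Let $G=(V,E)$ be a finite connected simple graph with at least two vertices. In the wiretap game the wiretapper picks an edge $e\in E$, the hider picks the edge set $S\subseteq E$ of a connected spanning subgraph of $G$ (a CSG), and the wiretapper's payoff is $1$ if $e\in S$ and $0$ otherwise. An edge distribution is a probability distribution $\alpha$ on $E$; put $\alpha(S)=\sum_{e\in S}\alpha(e)$. The value of the game is $val=\max_\alpha\min_S\alpha(S)$, and $\alpha$ is a maxmin strategy if $\alpha(S)\ge val$ for every CSG $S$. Let $\mathcal E(\alpha)$ be the partition of $E$ into the classes of edges of equal $\alpha$-weight. A partition refines another one if each of its elements is contained in an element of the other. For $F\subseteq E$ let $C(F)$ be the number of connected components of $(V,E\setminus F)$; let $cr(F)=\frac{C(F)-1}{|F|}$ if $F\neq\emptyset$, $cr(\emptyset)=0$, and $opt=\max_{F\subseteq E}cr(F)$. The prime-partition $\mathcal P$ is the partition of $E$ that equals $\mathcal E(\beta)$ for some maxmin strategy $\beta$ and refines $\mathcal E(\gamma)$ for every maxmin strategy $\gamma$. The degenerate set $D$ is the element of $\mathcal P$ on which every maxmin strategy vanishes ($D=\emptyset$ if there is none); the elements of $\mathcal P\setminus\{D\}$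 are called nondegenerate. An omni-connected-spanning-subgraph (OCSG) is a CSG $H$ with $|H\cap P|=|P|\cdot opt$ for every nondegenerate $P$. For distinct nondegenerate $P,P'$, $P$ leads to $P'$ (written $P\,\mathcal R\,P'$) if there are an OCSG $H$, $e\in P\setminus H$ and $e'\in P'\cap H$ such that $(H\setminus\{e'\})\cup\{e\}$ is a CSG. $P$ is a parent of $P'$ (and $P'$ a child of $P$) if $P$ leads to $P'$ and there is no $P''\in\mathcal P$ such that $P$ leads to $P''$ and $P''$ leads to $P'$. An edge distribution $\alpha$ agrees with a relation $\mathcal T$ on the nondegenerate elements if it is constant on each element of $\mathcal P$, it is zero on $D$, and $\alpha(e)\ge\alpha(e')$ whenever $P\,\mathcal T\,P'$, $e\in P$, $e'\in P'$. Theorem. The prime-partition $\mathcal P$ exists and is unique, and the following hold. 1. An edge distribution is a maxmin strategy if and only if it agrees with $\mathcal R$. 2. An edge distribution is a maxmin strategy if and only if it agrees with the parent–child relation. 3. Within the probability distributions on $E$, the polytope of maxmin strategies is the solution set of the equations $\alpha(e)=0$ for $e\in D$ together with a system of two-variable inequalities of the form $\alpha(e)\ge\alpha(e')$. The system consists of at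 most $|E|-|D|$ inequalities between edges of the same nondegenerate element, and exactly as many further inequalities as there are parent–child pairs, each between an edge of a parent and an edge of one of its children. In particular, the size of the system is linear in $|E|$ plus the number of parent–child pairs. 4. The relation $\mathcal R$ is acyclic. -/

import Mathlib

namespace Wiretap

variable {V : Type*} [Fintype V] [DecidableEq V] (G : SimpleGraph V) [DecidableRel G.Adj]

/-- A set `S` of edges of `G` is (the edge set of) a connected spanning subgraph of `G`:
the graph `(V, S)` is connected. -/
def IsCSG (S : Finset G.edgeSet) : Prop :=
  (SimpleGraph.fromEdgeSet (Subtype.val '' (S : Set G.edgeSet))).Connected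

/-- The pure strategies of the hider: the connected spanning subgraphs of `G`. -/
abbrev CSG : Type _ := {S : Finset G.edgeSet // IsCSG G S}

/-- The edge distributions `Δ(E)`, that is, the mixed strategies of the wiretapper. -/
abbrev EdgeDist : Set (G.edgeSet → ℝ) := stdSimplex ℝ G.edgeSet

/-- The probability of a successful wiretap, when the wiretapper plays `x` and the hider `S`. -/
def weight (x : G.edgeSet → ℝ) (S : Finset G.edgeSet) : ℝ := ∑ e ∈ S, x e

/-- The value of the wiretap game, `max_{x ∈ Δ(E)} min_S x(S)`. -/
noncomputable def value : ℝ :=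
  ⨆ x : EdgeDist G, ⨅ S : CSG G, weight G x.1 S.1

/-- The maxmin strategies of the wiretapper. -/
def IsMaxmin (x : G.edgeSet → ℝ) : Prop :=
  x ∈ EdgeDist G ∧ ∀ S : Finset G.edgeSet, IsCSG G S → value G ≤ weight G x S

/-- The number of connected components of `G ∖ F = (V, E ∖ F)`. -/
noncomputable def numComponents (F : Finset G.edgeSet) : ℕ :=
  Nat.card (G.deleteEdges (Subtype.val '' (F : Set G.edgeSet))).ConnectedComponent

/-- The cut-rate of a set of edges. -/
noncomputable def cutRate (F : Finset G.edgeSet) : ℝ :=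
  if 1 < Fintype.card V ∧ 0 < F.card then
    ((numComponents G F : ℝ) - (numComponents G ∅ : ℝ)) / (F.card : ℝ)
  else 0

/-- The cut-rate of the graph, `max_{F ⊆ E} cutRate F`; the maximum is over a finite nonempty
family. -/
noncomputable def opt : ℝ := ⨆ F : Finset G.edgeSet, cutRate G F

open Classical in
/-- The partition of the edges into the classes of equal weight. -/
noncomputable def weightPartition (x : G.edgeSet → ℝ) :
    Finpartition (Finset.univ : Finset G.edgeSet) :=
  Finpartition.ofSetoid (Setoid.ker x)

/-- `pp` is the partition by weight of some maxmin strategy, and refines the partition by weight of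
every maxmin strategy. The order on `Finpartition` is refinement: `pp ≤ qq` means that every part
of `pp` is contained in a part of `𝒬`. -/
def IsPrimePartition (pp : Finpartition (Finset.univ : Finset G.edgeSet)) : Prop :=
  (∃ β, IsMaxmin G β ∧ weightPartition G β = pp) ∧
    ∀ γ, IsMaxmin G γ → pp ≤ weightPartition G γ

variable (pp : Finpartition (Finset.univ : Finset G.edgeSet))

open Classical in
/-- The degenerate set: the element of `pp` on which every maxmin strategy vanishes, or `∅` if there
is none. (There is at most one such element, see `degenerateSet_eq`.) -/
noncomputable def degenerateSet : Finset G.edgeSet :=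
  (pp.parts.filter fun P => ∀ x, IsMaxmin G x → ∀ e ∈ P, x e = 0).biUnion id

/-- The nondegenerate elements `pp ∖ {D}`. -/
noncomputable def nondegenerateParts : Finset (Finset G.edgeSet) :=
  pp.parts.erase (degenerateSet G pp)

/-- `H` is an omni-connected-spanning-subgraph: a connected spanning subgraph with
`|H ∩ P| = |P| · opt` for every nondegenerate element `P`. -/
def IsOCSG (H : Finset G.edgeSet) : Prop :=
  IsCSG G H ∧ ∀ P ∈ nondegenerateParts G pp, ((H ∩ P).card : ℝ) = (P.card : ℝ) * opt G

/-- The relation "`P` leads to `P'`". -/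
def LeadsTo (P P' : Finset G.edgeSet) : Prop :=
  P ∈ nondegenerateParts G pp ∧ P' ∈ nondegenerateParts G pp ∧ P ≠ P' ∧
    ∃ H, IsOCSG G pp H ∧ ∃ e ∈ P \ H, ∃ e' ∈ P' ∩ H, IsCSG G (insert e (H.erase e'))

/-- The relation "`P` is a parent of `P'`". -/
def IsParent (P P' : Finset G.edgeSet) : Prop :=
  LeadsTo G pp P P' ∧ ¬ ∃ P'' ∈ pp.parts, LeadsTo G pp P P'' ∧ LeadsTo G pp P'' P'

open Classical in
/-- The set of all parent–child pairs. -/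
noncomputable def parentChildPairs : Finset (Finset G.edgeSet × Finset G.edgeSet) :=
  (pp.parts ×ˢ pp.parts).filter fun p => IsParent G pp p.1 p.2

/-- `x` agrees with the relation `R` on the elements of `pp`. -/
def Agrees (R : Finset G.edgeSet → Finset G.edgeSet → Prop) (x : G.edgeSet → ℝ) : Prop :=
  pp ≤ weightPartition G x ∧
    (∀ P ∈ nondegenerateParts G pp, ∀ P' ∈ nondegenerateParts G pp, R P P' →
      ∀ e ∈ P, ∀ e' ∈ P', x e' ≤ x e) ∧
    ∀ e ∈ degenerateSet G pp, x e = 0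

theorem mem_weightPartition_iff (x : G.edgeSet → ℝ) {P : Finset G.edgeSet}
    (hP : P ∈ (weightPartition G x).parts) {e f : G.edgeSet} (he : e ∈ P) :
    f ∈ P ↔ x f = x e := by
  classical
  simp only [weightPartition, Finpartition.ofSetoid, Finpartition.ofSetSetoid,
    Finset.mem_image, Finset.mem_univ, true_and] at hP
  obtain ⟨a, rfl⟩ := hP
  have he' : x a = x e := by simpa [Setoid.ker, Function.onFun] using he
  have : f ∈ ({b | (Setoid.ker x) a b} : Finset G.edgeSet) ↔ x a = x f := by
    simp
  refine this.trans ?_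
  rw [he']
  exact eq_comm

theorem degenerateSet_eq (hpp : IsPrimePartition G pp) {D : Finset G.edgeSet} (hD : D ∈ pp.parts)
    (h : ∀ x, IsMaxmin G x → ∀ e ∈ D, x e = 0) : degenerateSet G pp = D := by
  classical
  obtain ⟨⟨β, hβ, rfl⟩, -⟩ := hpp
  have key : ∀ P ∈ (weightPartition G β).parts,
      (∀ x, IsMaxmin G x → ∀ e ∈ P, x e = 0) → P = D := by
    intro P hP hz
    obtain ⟨e, he⟩ := (weightPartition G β).nonempty_of_mem_parts hP
    obtain ⟨d, hd⟩ := (weightPartition G β).nonempty_of_mem_parts hD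
    ext f
    rw [mem_weightPartition_iff G β hP he, mem_weightPartition_iff G β hD hd,
      hz β hβ e he, h β hβ d hd]
  ext f
  simp only [degenerateSet, Finset.mem_biUnion, Finset.mem_filter, id]
  constructor
  · rintro ⟨P, ⟨hP, hz⟩, hf⟩
    rwa [← key P hP hz]
  · intro hf
    exact ⟨D, ⟨hD, h⟩, hf⟩

end Wiretap

/-! Call F tight when C(F) - 1 = |F|·opt. Every CSG meets F in at least C(F) - 1 edges, and a
minimum-weight CSG meets each upper level set of the weights in exactly that many (`exists_greedy`).
Writing a distribution as a positive combination of its level sets therefore gives val = opt, and a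
distribution is maxmin exactly when its positive level sets are tight (`isMaxmin_iff_tight`).

Hence the elements of the prime partition are the classes of edges lying in the same tight sets, and
D is the class lying in none. A combination of all tight sets with distinct powers of two as
coefficients realises this partition (`exists_separating_maxmin`).

An OCSG meets every tight set in the minimum number of edges. If P leads to P', a tight set
containing P' contains P, since otherwise the swap would go below the minimum
(`LeadsTo.mem_of_tight`). Conversely, a union of nondegenerate elements closed under predecessors is
tight: an excess edge of an OCSG could be exchanged for one outside, exhibiting a missing
predecessor (`Saturated.tight`). Agreeing with R says precisely that the positive level sets are
such unions. The number of tight sets containing an element drops strictly along R, so R is acyclic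
and is contained in the transitive closure of the parent–child relation. -/

set_option linter.unusedSectionVars false

/-! ### Counting components and exchanging edges. -/

namespace Wiretap

variable {V : Type*} [Fintype V] [DecidableEq V] (G : SimpleGraph V) [DecidableRel G.Adj]

/-- The spanning subgraph `(V, A)` of `G`. -/
abbrev edgeGraph (A : Finset G.edgeSet) : SimpleGraph V :=
  SimpleGraph.fromEdgeSet (Subtype.val '' (A : Set G.edgeSet))

/-- The number of connected components of `(V, A)`. -/
noncomputable def comps (A : Finset G.edgeSet) : ℕ := Nat.card (edgeGraph G A).ConnectedComponent

/-- The endpoints of `e` lie in the same component of `(V, A)`. -/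
def Spans (A : Finset G.edgeSet) (e : G.edgeSet) : Prop :=
  ∀ u v, e.1 = s(u, v) → (edgeGraph G A).Reachable u v

variable {G}

theorem edgeGraph_adj {A : Finset G.edgeSet} {a b : V} :
    (edgeGraph G A).Adj a b ↔ ∃ e ∈ A, e.1 = s(a, b) := by
  constructor
  · rintro ⟨⟨e, he, h⟩, -⟩
    exact ⟨e, he, h⟩
  · rintro ⟨e, he, h⟩
    refine ⟨⟨e, he, h⟩, ?_⟩
    have : s(a, b) ∈ G.edgeSet := h ▸ e.2
    exact G.ne_of_adj this

theorem spans_of_mem {A : Finset G.edgeSet} {e : G.edgeSet} (h : e ∈ A) : Spans G A e :=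
  fun _ _ huv => (edgeGraph_adj.2 ⟨e, h, huv⟩).reachable

theorem reachable_of_forall_spans {A T : Finset G.edgeSet} (h : ∀ e ∈ A, Spans G T e) {a b : V}
    (hab : (edgeGraph G A).Reachable a b) : (edgeGraph G T).Reachable a b := by
  rw [SimpleGraph.reachable_iff_reflTransGen] at hab
  induction hab with
  | refl => exact .refl _
  | tail _ hbc ih =>
    obtain ⟨e, he, h'⟩ := edgeGraph_adj.1 hbc
    exact ih.trans (h e he _ _ h')

theorem Spans.mono {A B : Finset G.edgeSet} (hAB : A ⊆ B) {e : G.edgeSet} (h : Spans G A e) :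
    Spans G B e :=
  fun u v huv => reachable_of_forall_spans (fun _ he => spans_of_mem (hAB he)) (h u v huv)

/-- A walk needs to cross the new edge at most once; the alternatives are no crossing and a crossing
in either direction. -/
theorem reachable_insert {A : Finset G.edgeSet} {e : G.edgeSet} {u v a b : V} (he : e.1 = s(u, v))
    (hab : (edgeGraph G (insert e A)).Reachable a b) :
    (edgeGraph G A).Reachable a b ∨
      ((edgeGraph G A).Reachable a u ∧ (edgeGraph G A).Reachable v b) ∨
      ((edgeGraph G A).Reachable a v ∧ (edgeGraph G A).Reachable u b) := by
  rw [SimpleGraph.reachable_iff_reflTransGen] at hab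
  induction hab with
  | refl => exact .inl (.refl _)
  | @tail b c _ hbc ih =>
    obtain ⟨f, hf, h'⟩ := edgeGraph_adj.1 hbc
    rcases Finset.mem_insert.1 hf with rfl | hf
    · rw [he, Sym2.eq_iff] at h'
      rcases h' with ⟨rfl, rfl⟩ | ⟨rfl, rfl⟩
      · rcases ih with h | ⟨h, -⟩ | ⟨h, -⟩
        · exact .inr (.inl ⟨h, .refl _⟩)
        · exact .inr (.inl ⟨h, .refl _⟩)
        · exact .inl h
      · rcases ih with h | ⟨h, -⟩ | ⟨h, -⟩
        · exact .inr (.inr ⟨h, .refl _⟩)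
        · exact .inl h
        · exact .inr (.inr ⟨h, .refl _⟩)
    · have hbc' := (edgeGraph_adj.2 ⟨f, hf, h'⟩).reachable
      rcases ih with h | ⟨h, h2⟩ | ⟨h, h2⟩
      · exact .inl (h.trans hbc')
      · exact .inr (.inl ⟨h, h2.trans hbc'⟩)
      · exact .inr (.inr ⟨h, h2.trans hbc'⟩)

theorem edgeGraph_mono {A B : Finset G.edgeSet} (h : A ⊆ B) : edgeGraph G A ≤ edgeGraph G B :=
  SimpleGraph.fromEdgeSet_mono (Set.image_mono (by exact_mod_cast h))

theorem comps_insert_of_spans {A : Finset G.edgeSet} {e : G.edgeSet} (h : Spans G A e) :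
    comps G (insert e A) = comps G A := by
  have hle := edgeGraph_mono (Finset.subset_insert e A)
  symm
  refine Nat.card_eq_of_bijective (SimpleGraph.ConnectedComponent.map (.ofLE hle))
    ⟨?_, SimpleGraph.ConnectedComponent.surjective_map_ofLE hle⟩
  intro c d
  refine SimpleGraph.ConnectedComponent.ind₂ (fun a b hab => ?_) c d
  simp only [SimpleGraph.ConnectedComponent.map_mk, SimpleGraph.ConnectedComponent.eq] at hab ⊢
  refine reachable_of_forall_spans (fun f hf => ?_) hab
  rcases Finset.mem_insert.1 hf with rfl | hf
  exacts [h, spans_of_mem hf]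

theorem comps_eq_comps_insert_add_one {A : Finset G.edgeSet} {e : G.edgeSet}
    (h : ¬ Spans G A e) : comps G A = comps G (insert e A) + 1 := by
  classical
  simp only [Spans, not_forall] at h
  obtain ⟨u, v, he, h⟩ := h
  have hle := edgeGraph_mono (Finset.subset_insert e A)
  have huv : (edgeGraph G (insert e A)).Reachable u v :=
    (edgeGraph_adj.2 ⟨e, Finset.mem_insert_self _ _, he⟩).reachable
  let c₀ := (edgeGraph G A).connectedComponentMk v
  -- Inserting `e` merges the component of `v` into that of `u` and changes no other, so the
  -- components other than `c₀` biject with the new ones.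
  have key : Nat.card {c : (edgeGraph G A).ConnectedComponent // c ≠ c₀} =
      comps G (insert e A) := by
    refine Nat.card_eq_of_bijective
      (fun c => SimpleGraph.ConnectedComponent.map (.ofLE hle) c.1) ⟨?_, ?_⟩
    · rintro ⟨c, hc⟩ ⟨d, hd⟩
      induction c using SimpleGraph.ConnectedComponent.ind with | _ a
      induction d using SimpleGraph.ConnectedComponent.ind with | _ b
      intro hab
      simp only [SimpleGraph.ConnectedComponent.map_mk, SimpleGraph.ConnectedComponent.eq, c₀, ne_eq,
        Subtype.mk.injEq] at hab hc hd ⊢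
      rcases reachable_insert he hab with h1 | ⟨-, h1⟩ | ⟨h1, -⟩
      · exact h1
      · exact (hd h1.symm).elim
      · exact (hc h1).elim
    · intro c
      induction c using SimpleGraph.ConnectedComponent.ind with | _ a
      by_cases ha : (edgeGraph G A).Reachable a v
      · refine ⟨⟨(edgeGraph G A).connectedComponentMk u, ?_⟩, ?_⟩
        · simpa [c₀, SimpleGraph.ConnectedComponent.eq] using h
        · simp only [SimpleGraph.ConnectedComponent.map_mk, SimpleGraph.ConnectedComponent.eq]
          exact huv.trans (ha.mono hle).symm
      · refine ⟨⟨(edgeGraph G A).connectedComponentMk a, ?_⟩, rfl⟩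
        simpa [c₀, SimpleGraph.ConnectedComponent.eq] using ha
  rw [← key, comps, Nat.card_eq_fintype_card, Nat.card_eq_fintype_card,
    Fintype.card_subtype_compl, Fintype.card_subtype_eq]
  have : 0 < Fintype.card (edgeGraph G A).ConnectedComponent := Fintype.card_pos_iff.2 ⟨c₀⟩
  omega

theorem isCSG_iff_comps [Nonempty V] {S : Finset G.edgeSet} : IsCSG G S ↔ comps G S = 1 := by
  rw [comps, Nat.card_eq_one_iff_unique, IsCSG, SimpleGraph.connected_iff]
  constructor
  · rintro ⟨h, -⟩
    exact ⟨h.subsingleton_connectedComponent,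
      ⟨SimpleGraph.connectedComponentMk _ (Classical.arbitrary V)⟩⟩
  · rintro ⟨h, -⟩
    exact ⟨fun a b => SimpleGraph.ConnectedComponent.exact (h.elim _ _), inferInstance⟩

theorem IsCSG.mono {S T : Finset G.edgeSet} (h : S ⊆ T) (hS : IsCSG G S) : IsCSG G T :=
  SimpleGraph.Connected.mono (edgeGraph_mono h) hS

theorem comps_le_comps_union_add_card (A B : Finset G.edgeSet) :
    comps G A ≤ comps G (A ∪ B) + B.card := by
  induction B using Finset.induction_on with
  | empty => simp
  | insert e B he ih =>
    rw [Finset.union_insert, Finset.card_insert_of_notMem he]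
    by_cases h : Spans G (A ∪ B) e
    · rw [comps_insert_of_spans h]; omega
    · have := comps_eq_comps_insert_add_one h; omega

/-- Each edge of `B` is a bridge over `A` and the rest of `B`, so adding `B` edge by edge merges two
components every time. -/
theorem comps_eq_comps_union_add_card {A B : Finset G.edgeSet}
    (h : ∀ e ∈ B, ¬ Spans G (A ∪ B.erase e) e) : comps G A = comps G (A ∪ B) + B.card := by
  induction B using Finset.induction_on with
  | empty => simp
  | insert e B he ih =>
    rw [Finset.union_insert, Finset.card_insert_of_notMem he]
    have h1 := h e (Finset.mem_insert_self _ _)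
    rw [Finset.erase_insert he] at h1
    have := comps_eq_comps_insert_add_one h1
    rw [ih fun f hf hs => h f (Finset.mem_insert_of_mem hf) (hs.mono ?_)]
    · omega
    · exact Finset.union_subset_union_right
        (Finset.erase_subset_erase _ (Finset.subset_insert _ _))

theorem numComponents_eq_comps (F : Finset G.edgeSet) : numComponents G F = comps G Fᶜ := by
  have : G.deleteEdges (Subtype.val '' (F : Set G.edgeSet)) = edgeGraph G Fᶜ := by
    ext a b
    rw [edgeGraph_adj, SimpleGraph.deleteEdges_adj]
    constructor
    · rintro ⟨h, h'⟩
      exact ⟨⟨s(a, b), h⟩, by simpa using fun hF => h' ⟨_, hF, rfl⟩, rfl⟩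
    · rintro ⟨e, he, h⟩
      refine ⟨G.mem_edgeSet.1 (h ▸ e.2), ?_⟩
      rintro ⟨f, hf, hfe⟩
      obtain rfl : f = e := Subtype.ext (hfe.trans h.symm)
      simp at he hf
      exact he hf
  rw [numComponents, comps, this]

theorem compl_union_inter (S F : Finset G.edgeSet) : Fᶜ ∪ S ∩ F = Fᶜ ∪ S := by
  ext e; simp; tauto

variable [Nonempty V]

/-- The edges of `S ∩ F` alone must join all components of the graph without `F`, and each edge
merges at most two. -/
theorem numComponents_le {S : Finset G.edgeSet} (hS : IsCSG G S) (F : Finset G.edgeSet) :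
    numComponents G F ≤ (S ∩ F).card + 1 := by
  rw [numComponents_eq_comps]
  have h := comps_le_comps_union_add_card Fᶜ (S ∩ F)
  rw [compl_union_inter, isCSG_iff_comps.1 (hS.mono Finset.subset_union_right)] at h
  omega

/-- If a connected spanning subgraph uses more edges of `F` than necessary, then one of them can
be deleted, or exchanged for an edge outside `F`. -/
theorem exists_exchange {S F : Finset G.edgeSet} (hS : IsCSG G S)
    (hF : numComponents G F ≠ (S ∩ F).card + 1) :
    ∃ e' ∈ S ∩ F, IsCSG G (S.erase e') ∨
      ∃ e, e ∉ F ∧ e ∉ S ∧ IsCSG G (insert e (S.erase e')) := by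
  -- If every edge of `S ∩ F` were a bridge here, the count would drop by one per edge down to 1,
  -- contradicting `hF`.
  have h1 : ∃ e' ∈ S ∩ F, Spans G (Fᶜ ∪ (S ∩ F).erase e') e' := by
    by_contra! h
    have h := comps_eq_comps_union_add_card h
    rw [compl_union_inter, isCSG_iff_comps.1 (hS.mono Finset.subset_union_right)] at h
    rw [numComponents_eq_comps] at hF
    omega
  obtain ⟨e', he', hsp⟩ := h1
  have heS := Finset.mem_of_mem_inter_left he'
  have hκ := isCSG_iff_comps.1 hS
  rw [← Finset.insert_erase heS] at hκ
  refine ⟨e', he', ?_⟩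
  by_cases hT : Spans G (S.erase e') e'
  · left
    rw [isCSG_iff_comps, ← comps_insert_of_spans hT, hκ]
  · right
    have hT' := comps_eq_comps_insert_add_one hT
    -- Deleting `e'` splits `S` in two. The connection of its ends through `Fᶜ` and the rest of `S ∩
    -- F` must cross the split, necessarily by an edge outside `F`.
    have : ∃ e, e ∉ F ∧ ¬ Spans G (S.erase e') e := by
      by_contra! hall
      refine hT fun u v huv => reachable_of_forall_spans (fun f hf => ?_) (hsp u v huv)
      rcases Finset.mem_union.1 hf with hf | hf
      · exact hall f (Finset.mem_compl.1 hf)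
      · exact spans_of_mem (Finset.erase_subset_erase _ Finset.inter_subset_left hf)
    obtain ⟨e, heF, he⟩ := this
    refine ⟨e, heF, fun h => he (spans_of_mem (Finset.mem_erase.2 ⟨?_, h⟩)), ?_⟩
    · rintro rfl
      exact heF (Finset.mem_of_mem_inter_right he')
    · rw [isCSG_iff_comps]
      have := comps_eq_comps_insert_add_one he
      omega

end Wiretap

/-! ### Summation over upper level sets. -/

section Layers

variable {ι : Type*} [Fintype ι]

/-- Lowering the upper level set `{t₀ ≤ x}` by at most the gap below it creates no new
upper level sets. -/
theorem exists_level_iff_of_peel {x : ι → ℝ} {t₀ δ : ℝ} (hδ : 0 < δ)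
    (hgap : ∀ e, x e < t₀ → x e ≤ t₀ - δ) {t : ℝ} (ht : 0 < t) :
    ∃ s, 0 < s ∧ ∀ e, t ≤ (if t₀ ≤ x e then x e - δ else x e) ↔ s ≤ x e := by
  by_cases h : t ≤ t₀ - δ
  · refine ⟨t, ht, fun e => ?_⟩
    split_ifs with he
    · constructor <;> intro <;> linarith
    · rfl
  · refine ⟨t + δ, by linarith, fun e => ?_⟩
    split_ifs with he
    · constructor <;> intro <;> linarith
    · have := hgap e (not_le.1 he)
      constructor <;> intro <;> linarith

theorem sum_peel (x g : ι → ℝ) (t₀ δ : ℝ) :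
    ∑ e, x e * g e = ∑ e, (if t₀ ≤ x e then x e - δ else x e) * g e +
      δ * ∑ e with t₀ ≤ x e, g e := by
  rw [Finset.sum_filter, Finset.mul_sum, ← Finset.sum_add_distrib]
  refine Finset.sum_congr rfl fun e _ => ?_
  split_ifs <;> ring

/-- A nonnegative `x` is a positive combination of indicators of its positive level sets. The
induction lowers the whole support by its least value, which shrinks it. -/
theorem sum_mul_nonpos_of_levels (g : ι → ℝ) (x : ι → ℝ) (hx : ∀ e, 0 ≤ x e)
    (h : ∀ t, 0 < t → ∑ e with t ≤ x e, g e ≤ 0) : ∑ e, x e * g e ≤ 0 := by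
  classical
  induction hn : (Finset.univ.filter fun e => 0 < x e).card using Nat.strong_induction_on
    generalizing x with
  | _ n ih =>
  rcases (Finset.univ.filter fun e => 0 < x e).eq_empty_or_nonempty with h0 | h0
  · refine (Finset.sum_eq_zero fun e _ => ?_).le
    have : ¬ 0 < x e := by simpa using (Finset.filter_eq_empty_iff.1 h0) (Finset.mem_univ e)
    rw [le_antisymm (not_lt.1 this) (hx e), zero_mul]
  · obtain ⟨a, ha, hmin⟩ := Finset.exists_min_image _ x h0
    simp only [Finset.mem_filter, Finset.mem_univ, true_and] at ha hmin
    have hgap : ∀ e, x e < x a → x e ≤ x a - x a := fun e he => by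
      rw [sub_self]
      exact not_lt.1 fun h' => (hmin e h').not_gt he
    rw [sum_peel x g (x a) (x a)]
    have h1 := mul_nonpos_of_nonneg_of_nonpos ha.le (h _ ha)
    suffices h2 : ∑ e, (if x a ≤ x e then x e - x a else x e) * g e ≤ 0 by linarith
    refine ih _ ?_ (fun e => if x a ≤ x e then x e - x a else x e) (fun e => ?_)
      (fun t ht => ?_) rfl
    · rw [← hn]
      refine Finset.card_lt_card (Finset.ssubset_iff_of_subset ?_ |>.2 ⟨a, by simpa using ha, ?_⟩)
      · intro e
        simp only [Finset.mem_filter, Finset.mem_univ, true_and]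
        split_ifs with he
        · intro; linarith
        · exact id
      · simp
    · split_ifs with he
      · linarith
      · exact hx e
    · obtain ⟨s, hs, hst⟩ := exists_level_iff_of_peel ha hgap ht
      simp only [hst]
      exact h s hs

/-- There is a gap below every positive threshold. -/
theorem exists_gap (x : ι → ℝ) {t₀ : ℝ} (ht : 0 < t₀) :
    ∃ δ, 0 < δ ∧ δ ≤ t₀ ∧ ∀ e, x e < t₀ → x e ≤ t₀ - δ := by
  classical
  rcases (Finset.univ.filter fun e => x e < t₀).eq_empty_or_nonempty with h0 | h0
  · refine ⟨t₀, ht, le_rfl, fun e he => ?_⟩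
    exact absurd he (by simpa using (Finset.filter_eq_empty_iff.1 h0) (Finset.mem_univ e))
  · obtain ⟨a, ha, hmax⟩ := Finset.exists_max_image _ x h0
    simp only [Finset.mem_filter, Finset.mem_univ, true_and] at ha hmax
    refine ⟨min t₀ (t₀ - x a), lt_min ht (by linarith), min_le_left _ _, fun e he => ?_⟩
    have := hmax e he
    have := min_le_right t₀ (t₀ - x a)
    linarith

/-- Complementary slackness: peeling a layer of thickness δ > 0 off the level set leaves a
nonpositive sum, so a strictly negative layer would make the total negative. -/
theorem sum_level_eq_zero {g x : ι → ℝ} (hx : ∀ e, 0 ≤ x e)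
    (h : ∀ t, 0 < t → ∑ e with t ≤ x e, g e ≤ 0) (h0 : 0 ≤ ∑ e, x e * g e) {t : ℝ} (ht : 0 < t) :
    ∑ e with t ≤ x e, g e = 0 := by
  obtain ⟨δ, hδ, hδt, hgap⟩ := exists_gap x ht
  have h1 : ∑ e, (if t ≤ x e then x e - δ else x e) * g e ≤ 0 := by
    refine sum_mul_nonpos_of_levels g (fun e => if t ≤ x e then x e - δ else x e) (fun e => ?_)
      (fun r hr => ?_)
    · split_ifs with he
      · linarith
      · exact hx e
    · obtain ⟨s, hs, hst⟩ := exists_level_iff_of_peel hδ hgap hr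
      simp only [hst]
      exact h s hs
  rw [sum_peel x g t δ] at h0
  exact le_antisymm (h t ht) (nonneg_of_mul_nonneg_right (by linarith) hδ)

/-- Strict level sets are level sets too, so a single value class is the difference of two of them.
-/
theorem exists_le_iff_lt (x : ι → ℝ) (t : ℝ) : ∃ s, t < s ∧ ∀ e, t < x e ↔ s ≤ x e := by
  classical
  rcases (Finset.univ.filter fun e => t < x e).eq_empty_or_nonempty with h0 | h0
  · refine ⟨t + 1, by linarith, fun e => ⟨fun he => ?_, fun he => by linarith⟩⟩
    exact absurd he (by simpa using (Finset.filter_eq_empty_iff.1 h0) (Finset.mem_univ e))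
  · obtain ⟨a, ha, hmin⟩ := Finset.exists_min_image _ x h0
    simp only [Finset.mem_filter, Finset.mem_univ, true_and] at ha hmin
    exact ⟨x a, ha, fun e => ⟨hmin e, ha.trans_le⟩⟩

end Layers

/-! ### Tight sets and the value of the game. -/

namespace Wiretap

variable {V : Type*} [Fintype V] [DecidableEq V] {G : SimpleGraph V} [DecidableRel G.Adj]

/-- The upper level set `{e | t ≤ x e}`. -/
noncomputable def level (x : G.edgeSet → ℝ) (t : ℝ) : Finset G.edgeSet := {e | t ≤ x e}

@[simp]
theorem mem_level {x : G.edgeSet → ℝ} {t : ℝ} {e : G.edgeSet} : e ∈ level x t ↔ t ≤ x e := by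
  simp [level]

variable (G) in
/-- A set of edges is tight if it is empty or attains the maximal cut-rate. -/
def Tight (F : Finset G.edgeSet) : Prop := (numComponents G F : ℝ) - 1 = F.card * opt G

theorem isCSG_univ (hG : G.Connected) : IsCSG G Finset.univ := by
  have : edgeGraph G Finset.univ = G := by
    ext a b
    rw [edgeGraph_adj]
    exact ⟨fun ⟨e, _, h⟩ => G.mem_edgeSet.1 (h ▸ e.2), fun h => ⟨⟨s(a, b), h⟩, by simp, rfl⟩⟩
  change (edgeGraph G Finset.univ).Connected
  rwa [this]

/-- Every weight function admits a connected spanning subgraph that uses as few edges as possible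
of each of its upper level sets. -/
theorem exists_greedy [Nonempty V] (hG : G.Connected) (x : G.edgeSet → ℝ) :
    ∃ S, IsCSG G S ∧ ∀ t, numComponents G (level x t) = (S ∩ level x t).card + 1 := by
  classical
  -- The shift makes all weights positive, so deleting an edge strictly lowers the total; it cancels
  -- in a swap.
  let c : ℝ := 1 + ∑ e, |x e|
  have hc : ∀ e, 0 < x e + c := fun e => by
    have h1 := Finset.single_le_sum (f := fun e => |x e|) (fun _ _ => abs_nonneg _)
      (Finset.mem_univ e)
    have h2 := neg_abs_le (x e)
    simp only [c]
    linarith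
  obtain ⟨S, hS, hmin⟩ := Finset.exists_min_image
    (Finset.univ.filter fun S : Finset G.edgeSet => IsCSG G S) (fun S => ∑ e ∈ S, (x e + c))
    ⟨Finset.univ, by simpa using isCSG_univ hG⟩
  simp only [Finset.mem_filter, Finset.mem_univ, true_and] at hS hmin
  refine ⟨S, hS, fun t => ?_⟩
  by_contra hne
  obtain ⟨e', he', h | ⟨e, heF, heS, h⟩⟩ := exists_exchange hS hne
  · have h1 := hmin _ h
    rw [← Finset.add_sum_erase S _ (Finset.mem_of_mem_inter_left he')] at h1
    linarith [hc e']
  · have h1 := hmin _ h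
    rw [← Finset.add_sum_erase S _ (Finset.mem_of_mem_inter_left he'),
      Finset.sum_insert fun h => heS (Finset.mem_of_mem_erase h)] at h1
    have h2 := mem_level.1 (Finset.mem_of_mem_inter_right he')
    rw [mem_level] at heF
    linarith

theorem numComponents_empty [Nonempty V] (hG : G.Connected) : numComponents G ∅ = 1 := by
  rw [numComponents_eq_comps, Finset.compl_empty]
  exact isCSG_iff_comps.1 (isCSG_univ hG)

theorem tight_empty [Nonempty V] (hG : G.Connected) : Tight G ∅ := by
  simp [Tight, numComponents_empty hG]

theorem cutRate_of_nonempty [Nontrivial V] (hG : G.Connected) {F : Finset G.edgeSet}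
    (hF : F.Nonempty) : cutRate G F = ((numComponents G F : ℝ) - 1) / F.card := by
  rw [cutRate, if_pos ⟨Fintype.one_lt_card, hF.card_pos⟩, numComponents_empty hG, Nat.cast_one]

theorem numComponents_sub_one_le [Nontrivial V] (hG : G.Connected) (F : Finset G.edgeSet) :
    (numComponents G F : ℝ) - 1 ≤ F.card * opt G := by
  rcases F.eq_empty_or_nonempty with rfl | hF
  · exact (tight_empty hG).le
  · have h : cutRate G F ≤ opt G := le_ciSup (Set.finite_range (cutRate G)).bddAbove F
    have hpos : (0 : ℝ) < F.card := by exact_mod_cast hF.card_pos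
    rw [cutRate_of_nonempty hG hF, div_le_iff₀ hpos] at h
    linarith

theorem exists_tight_nonempty [Nontrivial V] (hG : G.Connected) :
    ∃ F : Finset G.edgeSet, F.Nonempty ∧ Tight G F := by
  obtain ⟨F, hF⟩ := exists_eq_ciSup_of_finite (f := cutRate G)
  have h2 : 2 ≤ numComponents G Finset.univ := by
    rw [numComponents_eq_comps, Finset.compl_univ]
    have h0 : 0 < comps G ∅ := by
      rw [comps, Nat.card_pos_iff]
      exact ⟨⟨SimpleGraph.connectedComponentMk _ (Classical.arbitrary V)⟩, inferInstance⟩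
    have h1 : comps G ∅ ≠ 1 := fun h => by
      obtain ⟨a, b, hab⟩ := exists_pair_ne V
      have := (isCSG_iff_comps.2 h).preconnected a b
      simp [hab] at this
    omega
  have huniv : (Finset.univ : Finset G.edgeSet).Nonempty := by
    rw [Finset.nonempty_iff_ne_empty]
    intro h
    rw [h, numComponents_empty hG] at h2
    omega
  -- Positivity rules out the empty set, of cut-rate 0 by convention, as the maximizer.
  have hpos : 0 < opt G := by
    refine lt_of_lt_of_le ?_ (le_ciSup (Set.finite_range (cutRate G)).bddAbove Finset.univ)
    rw [cutRate_of_nonempty hG huniv]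
    have : (2 : ℝ) ≤ numComponents G Finset.univ := by exact_mod_cast h2
    have : (0 : ℝ) < (Finset.univ : Finset G.edgeSet).card := by exact_mod_cast huniv.card_pos
    apply div_pos <;> linarith
  have hne : F.Nonempty := by
    rw [Finset.nonempty_iff_ne_empty]
    rintro rfl
    change _ = opt G at hF
    simp [cutRate] at hF
    linarith
  refine ⟨F, hne, ?_⟩
  have hc : (F.card : ℝ) ≠ 0 := by exact_mod_cast hne.card_pos.ne'
  change _ = opt G at hF
  rw [Tight, ← hF, cutRate_of_nonempty hG hne, mul_div_cancel₀ _ hc]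

theorem Tight.card_mul_opt_le [Nonempty V] {F S : Finset G.edgeSet} (hF : Tight G F)
    (hS : IsCSG G S) : F.card * opt G ≤ (S ∩ F).card := by
  have : (numComponents G F : ℝ) ≤ (S ∩ F).card + 1 := by exact_mod_cast numComponents_le hS F
  rw [← hF]
  linarith

theorem sum_level_indicator (S : Finset G.edgeSet) (x : G.edgeSet → ℝ) (r t : ℝ) :
    ∑ e with t ≤ x e, ((if e ∈ S then 1 else 0) - r) =
      ((S ∩ level x t).card : ℝ) - (level x t).card * r := by
  change ∑ e ∈ level x t, _ = _
  rw [Finset.sum_sub_distrib, Finset.sum_ite_mem, Finset.inter_comm]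
  simp

/-- With `g` the indicator of `S` minus `r`, layer sums measure the excess of the payoff over `r`,
because `x` has total mass 1. -/
theorem sum_mul_indicator (S : Finset G.edgeSet) {x : G.edgeSet → ℝ} (hx : x ∈ EdgeDist G)
    (r : ℝ) : ∑ e, x e * ((if e ∈ S then 1 else 0) - r) = weight G x S - r := by
  simp [mul_sub, Finset.sum_sub_distrib, ← Finset.sum_mul, hx.2, weight]

theorem greedy_sum_level_nonpos [Nontrivial V] (hG : G.Connected) {x : G.edgeSet → ℝ}
    {S : Finset G.edgeSet} (hS : ∀ t, numComponents G (level x t) = (S ∩ level x t).card + 1)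
    (t : ℝ) : ∑ e with t ≤ x e, ((if e ∈ S then 1 else 0) - opt G) ≤ 0 := by
  have := numComponents_sub_one_le hG (level x t)
  rw [hS t] at this
  rw [sum_level_indicator]
  push_cast at this
  linarith

theorem weight_greedy_le [Nontrivial V] (hG : G.Connected) {x : G.edgeSet → ℝ}
    (hx : x ∈ EdgeDist G) {S : Finset G.edgeSet}
    (hS : ∀ t, numComponents G (level x t) = (S ∩ level x t).card + 1) :
    weight G x S ≤ opt G := by
  have := sum_mul_nonpos_of_levels _ x hx.1 fun t _ => greedy_sum_level_nonpos hG hS t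
  rw [sum_mul_indicator S hx] at this
  linarith

theorem opt_le_weight_of_tight_levels [Nonempty V] {x : G.edgeSet → ℝ} (hx : x ∈ EdgeDist G)
    (h : ∀ t, 0 < t → Tight G (level x t)) {S : Finset G.edgeSet} (hS : IsCSG G S) :
    opt G ≤ weight G x S := by
  have := sum_mul_nonpos_of_levels (fun e => -((if e ∈ S then 1 else 0) - opt G)) x hx.1
    fun t ht => by
      rw [Finset.sum_neg_distrib, sum_level_indicator]
      linarith [(h t ht).card_mul_opt_le hS]
  simp only [mul_neg, Finset.sum_neg_distrib, sum_mul_indicator S hx] at this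
  linarith

/-- The uniform distribution on `F`. -/
noncomputable def uniform (F : Finset G.edgeSet) (e : G.edgeSet) : ℝ :=
  if e ∈ F then (F.card : ℝ)⁻¹ else 0

theorem uniform_mem {F : Finset G.edgeSet} (hF : F.Nonempty) : uniform F ∈ EdgeDist G := by
  refine ⟨fun e => ?_, ?_⟩
  · unfold uniform
    split_ifs <;> positivity
  · have : (F.card : ℝ) ≠ 0 := by exact_mod_cast hF.card_pos.ne'
    simp [uniform, this]

theorem opt_le_weight_uniform [Nonempty V] (hG : G.Connected) {F S : Finset G.edgeSet}
    (hF : F.Nonempty) (hT : Tight G F) (hS : IsCSG G S) : opt G ≤ weight G (uniform F) S := by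
  refine opt_le_weight_of_tight_levels (uniform_mem hF) (fun t ht => ?_) hS
  -- The positive level sets of the uniform distribution are `F` and the empty set.
  by_cases h : t ≤ (F.card : ℝ)⁻¹
  · convert hT using 1
    ext e
    rw [mem_level, uniform]
    split_ifs with he
    · simp [h, he]
    · simp [ht, he]
  · convert tight_empty hG using 1
    ext e
    rw [mem_level, uniform]
    split_ifs with he
    · simpa using h
    · simp [ht]

/-- The value of the wiretap game is the maximal cut-rate. -/
theorem value_eq_opt [Nontrivial V] (hG : G.Connected) : value G = opt G := by
  obtain ⟨F, hF, hT⟩ := exists_tight_nonempty hG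
  have : Nonempty (EdgeDist G) := ⟨⟨_, uniform_mem hF⟩⟩
  have : Nonempty (CSG G) := ⟨⟨_, isCSG_univ hG⟩⟩
  have hle : ∀ x : EdgeDist G, ⨅ S : CSG G, weight G x.1 S.1 ≤ opt G := fun x => by
    obtain ⟨S, hS, hgr⟩ := exists_greedy hG x.1
    exact (ciInf_le (Set.finite_range _).bddBelow (⟨S, hS⟩ : CSG G)).trans
      (weight_greedy_le hG x.2 hgr)
  refine le_antisymm (ciSup_le hle) ?_
  refine le_trans ?_ (le_ciSup (f := fun x : EdgeDist G => ⨅ S : CSG G, weight G x.1 S.1)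
    ⟨opt G, ?_⟩ ⟨_, uniform_mem hF⟩)
  · exact le_ciInf fun S => opt_le_weight_uniform hG hF hT S.2
  · rintro _ ⟨x, rfl⟩
    exact hle x

/-- A distribution is a maxmin strategy if and only if its upper level sets are tight. -/
theorem isMaxmin_iff_tight [Nontrivial V] (hG : G.Connected) {x : G.edgeSet → ℝ} :
    IsMaxmin G x ↔ x ∈ EdgeDist G ∧ ∀ t, 0 < t → Tight G (level x t) := by
  rw [IsMaxmin, value_eq_opt hG]
  refine and_congr_right fun hx => ⟨fun h t ht => ?_, fun h S => opt_le_weight_of_tight_levels hx h⟩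
  obtain ⟨S, hS, hgr⟩ := exists_greedy hG x
  -- Against the greedy `S` every layer is nonpositive, while maxmin makes the total nonnegative, so
  -- every positive layer vanishes.
  have h1 := sum_level_eq_zero hx.1 (fun t _ => greedy_sum_level_nonpos hG hgr t)
    (by rw [sum_mul_indicator S hx]; linarith [h S hS]) ht
  rw [sum_level_indicator] at h1
  rw [Tight, hgr t]
  push_cast
  linarith

theorem isMaxmin_uniform [Nontrivial V] (hG : G.Connected) {F : Finset G.edgeSet}
    (hF : F.Nonempty) (hT : Tight G F) : IsMaxmin G (uniform F) := by
  rw [IsMaxmin, value_eq_opt hG]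
  exact ⟨uniform_mem hF, fun S hS => opt_le_weight_uniform hG hF hT hS⟩

end Wiretap

/-! ### The prime partition, the degenerate set and OCSGs. -/

namespace Wiretap

variable {V : Type*} [Fintype V] [DecidableEq V] {G : SimpleGraph V} [DecidableRel G.Adj]
  {pp : Finpartition (Finset.univ : Finset G.edgeSet)}

variable (G) in
open Classical in
/-- The family of tight sets. -/
noncomputable def tightSets : Finset (Finset G.edgeSet) := {F | Tight G F}

theorem mem_tightSets {F : Finset G.edgeSet} : F ∈ tightSets G ↔ Tight G F := by
  simp [tightSets]

variable (G) in
/-- A positive combination of the tight sets with coefficients that are distinct powers of two. -/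
noncomputable def tightCode (e : G.edgeSet) : ℝ :=
  ∑ F ∈ tightSets G, if e ∈ F then (2 : ℝ) ^ (Fintype.equivFin (Finset G.edgeSet) F : ℕ) else 0

theorem tightCode_nonneg (e : G.edgeSet) : 0 ≤ tightCode G e :=
  Finset.sum_nonneg fun F _ => by split_ifs <;> positivity

theorem tightCode_pos {F : Finset G.edgeSet} (hF : Tight G F) {e : G.edgeSet} (he : e ∈ F) :
    0 < tightCode G e := by
  refine Finset.sum_pos' (fun F _ => by split_ifs <;> positivity) ⟨F, mem_tightSets.2 hF, ?_⟩
  rw [if_pos he]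
  positivity

/-- The binary digits of the code of an edge list the tight sets containing it. -/
theorem mem_iff_of_tightCode_eq {e f : G.edgeSet} (h : tightCode G e = tightCode G f)
    {F : Finset G.edgeSet} (hF : Tight G F) : e ∈ F ↔ f ∈ F := by
  classical
  let idx : Finset G.edgeSet ↪ ℕ :=
    (Fintype.equivFin (Finset G.edgeSet)).toEmbedding.trans Fin.valEmbedding
  have key : ∀ e, tightCode G e =
      ((∑ i ∈ ((tightSets G).filter (e ∈ ·)).map idx, 2 ^ i : ℕ) : ℝ) := fun e => by
    rw [tightCode, ← Finset.sum_filter, Finset.sum_map]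
    push_cast
    rfl
  rw [key, key, Nat.cast_inj] at h
  have h := Finset.map_injective _ (Finset.geomSum_injective le_rfl h)
  have h := Finset.ext_iff.1 h F
  simpa [mem_tightSets, hF] using h

theorem sum_tightCode (S : Finset G.edgeSet) : ∑ e ∈ S, tightCode G e =
    ∑ F ∈ tightSets G, (2 : ℝ) ^ (Fintype.equivFin (Finset G.edgeSet) F : ℕ) * (S ∩ F).card := by
  simp only [tightCode]
  rw [Finset.sum_comm]
  refine Finset.sum_congr rfl fun F _ => ?_
  rw [Finset.sum_ite_mem, Finset.sum_const, nsmul_eq_mul, mul_comm]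

/-- There is a maxmin strategy that is positive wherever possible and distinguishes any two edges
which are distinguished by a tight set. -/
theorem exists_separating_maxmin [Nontrivial V] (hG : G.Connected) :
    ∃ β, IsMaxmin G β ∧ (∀ e f, β e = β f → ∀ F, Tight G F → (e ∈ F ↔ f ∈ F)) ∧
      ∀ F, Tight G F → ∀ e ∈ F, 0 < β e := by
  obtain ⟨F₀, ⟨e₀, he₀⟩, hT₀⟩ := exists_tight_nonempty hG
  have hZ : 0 < ∑ e, tightCode G e :=
    Finset.sum_pos' (fun e _ => tightCode_nonneg e) ⟨e₀, Finset.mem_univ _, tightCode_pos hT₀ he₀⟩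
  refine ⟨fun e => tightCode G e / ∑ e, tightCode G e, ⟨⟨fun e => ?_, ?_⟩, fun S hS => ?_⟩,
    fun e f h F hF => ?_, fun F hF e he => div_pos (tightCode_pos hF he) hZ⟩
  · exact div_nonneg (tightCode_nonneg e) hZ.le
  · rw [← Finset.sum_div, div_self hZ.ne']
  · rw [weight, ← Finset.sum_div, le_div_iff₀ hZ, value_eq_opt hG, sum_tightCode, sum_tightCode,
      Finset.mul_sum]
    -- The bound holds for each tight set separately, since `S` contains at least `F.card * opt G`
    -- of its edges.
    refine Finset.sum_le_sum fun F hF => ?_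
    rw [Finset.univ_inter]
    have := (mem_tightSets.1 hF).card_mul_opt_le hS
    calc _ = (2 : ℝ) ^ (Fintype.equivFin (Finset G.edgeSet) F : ℕ) * (F.card * opt G) := by ring
      _ ≤ _ := by gcongr
  · exact mem_iff_of_tightCode_eq ((div_left_inj' hZ.ne').1 h) hF

/-- If `γ f` is positive, the level set at that height is tight and contains `f`, hence `e`. -/
theorem IsMaxmin.le_of_tight [Nontrivial V] (hG : G.Connected) {γ : G.edgeSet → ℝ}
    (hγ : IsMaxmin G γ) {e f : G.edgeSet} (h : ∀ F, Tight G F → f ∈ F → e ∈ F) :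
    γ f ≤ γ e := by
  have hγ' := (isMaxmin_iff_tight hG).1 hγ
  rcases (hγ'.1.1 f).eq_or_lt with h0 | h0
  · exact h0 ▸ hγ'.1.1 e
  · exact mem_level.1 (h _ (hγ'.2 _ h0) (by simp))

theorem IsMaxmin.eq_of_tight [Nontrivial V] (hG : G.Connected) {γ : G.edgeSet → ℝ}
    (hγ : IsMaxmin G γ) {e f : G.edgeSet} (h : ∀ F, Tight G F → (e ∈ F ↔ f ∈ F)) :
    γ e = γ f :=
  le_antisymm (hγ.le_of_tight hG fun F hF => (h F hF).1) (hγ.le_of_tight hG fun F hF => (h F hF).2)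

theorem le_weightPartition_iff {x : G.edgeSet → ℝ} :
    pp ≤ weightPartition G x ↔ ∀ P ∈ pp.parts, ∀ e ∈ P, ∀ f ∈ P, x e = x f := by
  constructor
  · intro h P hP e he f hf
    obtain ⟨Q, hQ, hPQ⟩ := h hP
    exact (mem_weightPartition_iff G x hQ (hPQ hf)).1 (hPQ he)
  · intro h P hP
    obtain ⟨e, he⟩ := pp.nonempty_of_mem_parts hP
    obtain ⟨Q, hQ, heQ⟩ := (weightPartition G x).exists_mem (Finset.mem_univ e)
    exact ⟨Q, hQ, fun f hf => (mem_weightPartition_iff G x hQ heQ).2 (h P hP f hf e he)⟩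

theorem isPrimePartition_weightPartition [Nontrivial V] (hG : G.Connected) {β : G.edgeSet → ℝ}
    (hβ : IsMaxmin G β) (hsep : ∀ e f, β e = β f → ∀ F, Tight G F → (e ∈ F ↔ f ∈ F)) :
    IsPrimePartition G (weightPartition G β) := by
  refine ⟨⟨β, hβ, rfl⟩, fun γ hγ => le_weightPartition_iff.2 fun P hP e he f hf => ?_⟩
  exact hγ.eq_of_tight hG (hsep e f ((mem_weightPartition_iff G β hP hf).1 he))

theorem IsPrimePartition.unique {pp qq : Finpartition (Finset.univ : Finset G.edgeSet)}
    (hp : IsPrimePartition G pp) (hq : IsPrimePartition G qq) : pp = qq := by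
  obtain ⟨⟨β, hβ, rfl⟩, h⟩ := id hp
  obtain ⟨⟨γ, hγ, rfl⟩, h'⟩ := id hq
  exact le_antisymm (h γ hγ) (h' β hβ)

theorem IsPrimePartition.mem_iff [Nontrivial V] (hG : G.Connected) (hp : IsPrimePartition G pp)
    {P : Finset G.edgeSet} (hP : P ∈ pp.parts) {e f : G.edgeSet} (he : e ∈ P) :
    f ∈ P ↔ ∀ F, Tight G F → (e ∈ F ↔ f ∈ F) := by
  obtain ⟨β, hβ, hsep, -⟩ := exists_separating_maxmin hG
  constructor
  · intro hf
    exact hsep e f (le_weightPartition_iff.1 (hp.2 β hβ) P hP e he f hf)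
  · intro h
    obtain ⟨⟨γ, hγ, rfl⟩, -⟩ := hp
    exact (mem_weightPartition_iff G γ hP he).2 (hγ.eq_of_tight hG h).symm

/-- The uniform distribution on a tight set is maxmin and positive there; conversely, positive
maxmin weight puts an edge in a tight level set. -/
theorem IsPrimePartition.mem_degenerateSet_iff [Nontrivial V] (hG : G.Connected)
    (hp : IsPrimePartition G pp) {e : G.edgeSet} :
    e ∈ degenerateSet G pp ↔ ∀ F, Tight G F → e ∉ F := by
  simp only [degenerateSet, Finset.mem_biUnion, Finset.mem_filter, id]
  constructor
  · rintro ⟨P, ⟨-, h0⟩, he⟩ F hF heF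
    have := h0 _ (isMaxmin_uniform hG ⟨e, heF⟩ hF) e he
    rw [uniform, if_pos heF, inv_eq_zero, Nat.cast_eq_zero, Finset.card_eq_zero] at this
    simp [this] at heF
  · intro h
    obtain ⟨P, hP, he⟩ := pp.exists_mem (Finset.mem_univ e)
    refine ⟨P, ⟨hP, fun x hx f hf => ?_⟩, he⟩
    have hx' := (isMaxmin_iff_tight hG).1 hx
    refine le_antisymm (not_lt.1 fun hpos => ?_) (hx'.1.1 f)
    exact h _ (hx'.2 _ hpos) (((hp.mem_iff hG hP he).1 hf _ (hx'.2 _ hpos)).2 (by simp))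

theorem mem_parts_of_nondegenerate {P : Finset G.edgeSet} (h : P ∈ nondegenerateParts G pp) :
    P ∈ pp.parts := Finset.mem_of_mem_erase h

theorem IsPrimePartition.mem_nondegenerateParts_iff [Nontrivial V] (hG : G.Connected)
    (hp : IsPrimePartition G pp) {P : Finset G.edgeSet} (hP : P ∈ pp.parts) {e : G.edgeSet}
    (he : e ∈ P) : P ∈ nondegenerateParts G pp ↔ e ∉ degenerateSet G pp := by
  rw [nondegenerateParts, Finset.mem_erase, and_iff_left hP]
  constructor
  · intro hne hmem
    have hD := (hp.mem_degenerateSet_iff hG).1 hmem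
    refine hne (degenerateSet_eq G pp hp hP fun x hx f hf => ?_).symm
    have hx' := (isMaxmin_iff_tight hG).1 hx
    refine le_antisymm (not_lt.1 fun hpos => ?_) (hx'.1.1 f)
    exact hD _ (hx'.2 _ hpos) (((hp.mem_iff hG hP he).1 hf _ (hx'.2 _ hpos)).2 (by simp))
  · rintro h rfl
    exact h he

/-- A union of nondegenerate elements of the partition. -/
def Saturated (pp : Finpartition (Finset.univ : Finset G.edgeSet)) (F : Finset G.edgeSet) : Prop :=
  (∀ P ∈ pp.parts, ∀ e ∈ P, ∀ f ∈ P, e ∈ F → f ∈ F) ∧ ∀ e ∈ F, e ∉ degenerateSet G pp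

theorem IsPrimePartition.saturated [Nontrivial V] (hG : G.Connected) (hp : IsPrimePartition G pp)
    {F : Finset G.edgeSet} (hF : Tight G F) : Saturated pp F :=
  ⟨fun _ hP _ he _ hf => ((hp.mem_iff hG hP he).1 hf F hF).1,
    fun _ he hD => (hp.mem_degenerateSet_iff hG).1 hD F hF he⟩

theorem Saturated.card_inter {F : Finset G.edgeSet} (hF : Saturated pp F) (H : Finset G.edgeSet) :
    (H ∩ F).card = ∑ P ∈ pp.parts with P ⊆ F, (H ∩ P).card := by
  classical
  rw [← Finset.card_biUnion]
  · congr 1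
    ext e
    simp only [Finset.mem_inter, Finset.mem_biUnion, Finset.mem_filter]
    constructor
    · rintro ⟨heH, heF⟩
      obtain ⟨P, hP, he⟩ := pp.exists_mem (Finset.mem_univ e)
      exact ⟨P, ⟨hP, fun f hf => hF.1 P hP e he f hf heF⟩, heH, he⟩
    · rintro ⟨P, ⟨-, hPF⟩, heH, he⟩
      exact ⟨heH, hPF he⟩
  · intro P hP Q hQ hPQ
    exact (pp.disjoint (Finset.mem_filter.1 hP).1 (Finset.mem_filter.1 hQ).1 hPQ).mono
      Finset.inter_subset_right Finset.inter_subset_right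

theorem IsOCSG.card_inter [Nontrivial V] (hG : G.Connected) (hp : IsPrimePartition G pp)
    {H F : Finset G.edgeSet} (hH : IsOCSG G pp H) (hF : Saturated pp F) :
    ((H ∩ F).card : ℝ) = F.card * opt G := by
  have h1 := hF.card_inter H
  have h2 := hF.card_inter Finset.univ
  simp only [Finset.univ_inter] at h2
  rw [h1, h2]
  push_cast
  rw [Finset.sum_mul]
  refine Finset.sum_congr rfl fun P hP => hH.2 P ?_
  rw [Finset.mem_filter] at hP
  obtain ⟨e, he⟩ := pp.nonempty_of_mem_parts hP.1
  exact (hp.mem_nondegenerateParts_iff hG hP.1 he).2 (hF.2 e (hP.2 he))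

theorem IsOCSG.numComponents_eq [Nontrivial V] (hG : G.Connected) (hp : IsPrimePartition G pp)
    {H F : Finset G.edgeSet} (hH : IsOCSG G pp H) (hF : Tight G F) :
    numComponents G F = (H ∩ F).card + 1 := by
  have h1 := hH.card_inter hG hp (hp.saturated hG hF)
  rw [← hF] at h1
  have : (numComponents G F : ℝ) = ((H ∩ F).card + 1 : ℕ) := by
    push_cast
    linarith
  exact_mod_cast this

/-- A greedy CSG for a separating strategy has the exact count on all positive level sets, hence on
their differences, the nondegenerate elements. Adding D changes no such count and ensures that edges
outside `H` are nondegenerate. -/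
theorem IsPrimePartition.exists_isOCSG [Nontrivial V] (hG : G.Connected)
    (hp : IsPrimePartition G pp) : ∃ H, IsOCSG G pp H ∧ degenerateSet G pp ⊆ H := by
  obtain ⟨β, hβ, hsep, hpos⟩ := exists_separating_maxmin hG
  obtain rfl := hp.unique (isPrimePartition_weightPartition hG hβ hsep)
  have hβ' := (isMaxmin_iff_tight hG).1 hβ
  obtain ⟨S, hS, hgr⟩ := exists_greedy hG β
  refine ⟨S ∪ degenerateSet G (weightPartition G β),
    ⟨hS.mono Finset.subset_union_left, fun P hP => ?_⟩, Finset.subset_union_right⟩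
  have hPp := mem_parts_of_nondegenerate hP
  obtain ⟨e, he⟩ := Finpartition.nonempty_of_mem_parts _ hPp
  have hnd : ∀ f ∈ P, f ∉ degenerateSet G (weightPartition G β) := fun f hf =>
    (hp.mem_nondegenerateParts_iff hG hPp hf).1 hP
  have heT := hnd e he
  rw [hp.mem_degenerateSet_iff hG] at heT
  push Not at heT
  obtain ⟨F, hF, heF⟩ := heT
  have hb := hpos F hF e heF
  obtain ⟨s, hs, hst⟩ := exists_le_iff_lt β (β e)
  have hgr' : ∀ t, 0 < t → ((S ∩ level β t).card : ℝ) = (level β t).card * opt G := fun t ht => by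
    rw [← hβ'.2 t ht, hgr t]
    push_cast
    ring
  have hPlevel : ∀ A : Finset G.edgeSet,
      (A ∩ level β (β e)).card = (A ∩ P).card + (A ∩ level β s).card := fun A => by
    rw [← Finset.card_union_of_disjoint]
    · congr 1
      ext f
      simp only [Finset.mem_inter, Finset.mem_union, mem_level, ← hst,
        mem_weightPartition_iff G β hPp he]
      rw [le_iff_lt_or_eq, eq_comm]
      tauto
    · rw [Finset.disjoint_left]
      intro f hf hf'
      simp only [Finset.mem_inter, mem_level, ← hst, mem_weightPartition_iff G β hPp he] at hf hf'
      exact hf'.2.ne' hf.2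
  have hSP : (S ∪ degenerateSet G (weightPartition G β)) ∩ P = S ∩ P := by
    ext f
    simp only [Finset.mem_inter, Finset.mem_union]
    have := hnd f
    tauto
  have h1 := hPlevel S
  have h2 := hPlevel Finset.univ
  simp only [Finset.univ_inter] at h2
  have h3 := hgr' _ hb
  have h4 := hgr' s (hb.trans hs)
  rw [h1, h2] at h3
  push_cast at h3
  rw [hSP]
  linarith

end Wiretap

/-! ### The relation R and its agreement with maxmin strategies. -/

namespace Wiretap

variable {V : Type*} [Fintype V] [DecidableEq V] {G : SimpleGraph V} [DecidableRel G.Adj]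
  {pp : Finpartition (Finset.univ : Finset G.edgeSet)}

/-- If `F` contained `P'` but not `P`, the swap would leave one edge fewer in `F` than the minimum,
which `H` already attains. -/
theorem LeadsTo.mem_of_tight [Nontrivial V] (hG : G.Connected) (hp : IsPrimePartition G pp)
    {P P' F : Finset G.edgeSet} (h : LeadsTo G pp P P') (hF : Tight G F) {e e' : G.edgeSet}
    (he : e ∈ P) (he' : e' ∈ P') (heF : e' ∈ F) : e ∈ F := by
  obtain ⟨hP, hP', -, H, hH, a, ha, a', ha', hcsg⟩ := h
  have hsat := (hp.saturated hG hF).1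
  rw [Finset.mem_sdiff] at ha
  rw [Finset.mem_inter] at ha'
  refine hsat P (mem_parts_of_nondegenerate hP) a ha.1 e he ?_
  have haF' := hsat P' (mem_parts_of_nondegenerate hP') e' he' a' ha'.1 heF
  by_contra haF
  have h1 := numComponents_le hcsg F
  rw [Finset.insert_inter_of_notMem haF, Finset.erase_inter,
    Finset.card_erase_of_mem (Finset.mem_inter.2 ⟨ha'.2, haF'⟩), hH.numComponents_eq hG hp hF] at h1
  have := Finset.card_pos.2 ⟨a', Finset.mem_inter.2 ⟨ha'.2, haF'⟩⟩
  omega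

/-- This set is the support of a separating strategy, that is, its lowest positive level set. -/
theorem IsPrimePartition.tight_compl_degenerateSet [Nontrivial V] (hG : G.Connected)
    (hp : IsPrimePartition G pp) : Tight G (degenerateSet G pp)ᶜ := by
  obtain ⟨β, hβ, -, hpos⟩ := exists_separating_maxmin hG
  have hβ' := (isMaxmin_iff_tight hG).1 hβ
  obtain ⟨s, hs, hst⟩ := exists_le_iff_lt β 0
  convert hβ'.2 s hs using 1
  ext e
  rw [Finset.mem_compl, mem_level, ← hst, hp.mem_degenerateSet_iff hG]
  constructor
  · intro h
    push Not at h
    obtain ⟨F, hF, he⟩ := h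
    exact hpos F hF e he
  · exact fun h h' => h' _ (hβ'.2 _ h) (by simp)

/-- A union of nondegenerate elements that is closed under predecessors is tight. -/
theorem Saturated.tight [Nontrivial V] (hG : G.Connected) (hp : IsPrimePartition G pp)
    {F : Finset G.edgeSet} (hF : Saturated pp F)
    (hcl : ∀ P P', LeadsTo G pp P P' → ∀ e ∈ P, ∀ e' ∈ P', e' ∈ F → e ∈ F) : Tight G F := by
  obtain ⟨H, hH, hDH⟩ := hp.exists_isOCSG hG
  by_contra hnot
  have hne : numComponents G F ≠ (H ∩ F).card + 1 := fun h => hnot <| by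
    rw [Tight, h, ← hH.card_inter hG hp hF]
    push_cast
    ring
  obtain ⟨e', he', h⟩ := exists_exchange hH.1 hne
  rw [Finset.mem_inter] at he'
  have heD := hF.2 e' he'.2
  rcases h with h | ⟨e, heF, heH, h⟩
  -- Deletion is impossible: `H` already has the minimum number of edges in the tight complement of
  -- D.
  · have h1 := numComponents_le h (degenerateSet G pp)ᶜ
    have hmem := Finset.mem_inter.2 ⟨he'.1, Finset.mem_compl.2 heD⟩
    rw [Finset.erase_inter, Finset.card_erase_of_mem hmem,
      hH.numComponents_eq hG hp (hp.tight_compl_degenerateSet hG)] at h1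
    have := Finset.card_pos.2 ⟨e', hmem⟩
    omega
  -- The swap shows that the element of `e`, nondegenerate because D lies in `H`, leads into `F`
  -- from outside, contradicting `hcl`.
  · obtain ⟨P, hP, he⟩ := pp.exists_mem (Finset.mem_univ e)
    obtain ⟨P', hP', heP'⟩ := pp.exists_mem (Finset.mem_univ e')
    refine heF (hcl P P' ⟨(hp.mem_nondegenerateParts_iff hG hP he).2 fun hD => heH (hDH hD),
      (hp.mem_nondegenerateParts_iff hG hP' heP').2 heD, ?_, H, hH, e,
      Finset.mem_sdiff.2 ⟨he, heH⟩, e', Finset.mem_inter.2 ⟨heP', he'.1⟩, h⟩ e he e' heP' he'.2)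
    rintro rfl
    exact heF (hF.1 P hP e' heP' e he he'.2)

theorem isMaxmin_iff_agrees_leadsTo [Nontrivial V] (hG : G.Connected) (hp : IsPrimePartition G pp)
    {x : G.edgeSet → ℝ} (hx : x ∈ EdgeDist G) :
    IsMaxmin G x ↔ Agrees G pp (LeadsTo G pp) x := by
  constructor
  · intro h
    refine ⟨hp.2 x h, fun P _ P' _ hPP' e he e' he' => h.le_of_tight hG fun F hF =>
      hPP'.mem_of_tight hG hp hF he he', fun e he => ?_⟩
    have hx' := (isMaxmin_iff_tight hG).1 h
    refine le_antisymm (not_lt.1 fun hpos => ?_) (hx.1 e)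
    exact (hp.mem_degenerateSet_iff hG).1 he _ (hx'.2 _ hpos) (by simp)
  · rintro ⟨hle, hR, hD⟩
    refine (isMaxmin_iff_tight hG).2 ⟨hx, fun t ht => Saturated.tight hG hp ⟨?_, ?_⟩ ?_⟩
    · intro P hP e he f hf h
      rw [mem_level] at h ⊢
      rwa [← le_weightPartition_iff.1 hle P hP e he f hf]
    · intro e he hmem
      rw [mem_level, hD e hmem] at he
      linarith
    · intro P P' h e he e' he' hmem
      rw [mem_level] at hmem ⊢
      exact hmem.trans (hR P h.1 P' h.2.1 h e he e' he')

open Classical in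
variable (G) in
/-- The number of tight sets containing `P`. -/
noncomputable def tightRank (P : Finset G.edgeSet) : ℕ := ((tightSets G).filter (P ⊆ ·)).card

/-- Tight sets containing `P'` contain `P`; were these families equal, `P` and `P'` would be the
same class. -/
theorem LeadsTo.tightRank_lt [Nontrivial V] (hG : G.Connected) (hp : IsPrimePartition G pp)
    {P P' : Finset G.edgeSet} (h : LeadsTo G pp P P') : tightRank G P' < tightRank G P := by
  classical
  have hP := mem_parts_of_nondegenerate h.1
  have hP' := mem_parts_of_nondegenerate h.2.1
  obtain ⟨e, he⟩ := pp.nonempty_of_mem_parts hP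
  obtain ⟨e', he'⟩ := pp.nonempty_of_mem_parts hP'
  have hsub : (tightSets G).filter (P' ⊆ ·) ⊆ (tightSets G).filter (P ⊆ ·) := fun F hF => by
    rw [Finset.mem_filter, mem_tightSets] at hF ⊢
    exact ⟨hF.1, fun f hf => h.mem_of_tight hG hp hF.1 hf he' (hF.2 he')⟩
  refine Finset.card_lt_card (hsub.ssubset_of_ne fun heq => h.2.2.1 ?_)
  refine pp.eq_of_mem_parts hP hP' he ((hp.mem_iff hG hP' he').2 fun F hF => ?_)
  refine ⟨h.mem_of_tight hG hp hF he he', fun heF => ?_⟩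
  have hmem : F ∈ (tightSets G).filter (P ⊆ ·) := by
    rw [Finset.mem_filter, mem_tightSets]
    exact ⟨hF, fun f hf => (hp.saturated hG hF).1 P hP e he f hf heF⟩
  rw [← heq, Finset.mem_filter] at hmem
  exact hmem.2 he'

theorem not_transGen_leadsTo [Nontrivial V] (hG : G.Connected) (hp : IsPrimePartition G pp)
    (P : Finset G.edgeSet) : ¬ Relation.TransGen (LeadsTo G pp) P P := by
  have : ∀ P P', Relation.TransGen (LeadsTo G pp) P P' → tightRank G P' < tightRank G P := by
    intro P P' h
    induction h with
    | single h => exact h.tightRank_lt hG hp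
    | tail _ h ih => exact (h.tightRank_lt hG hp).trans ih
  exact fun h => lt_irrefl _ (this P P h)

/-- A pair that is not parent–child splits at an intermediate element, and both halves have a
smaller rank difference. Transitivity of R is not needed. -/
theorem LeadsTo.transGen_isParent [Nontrivial V] (hG : G.Connected) (hp : IsPrimePartition G pp)
    {P P' : Finset G.edgeSet} (h : LeadsTo G pp P P') :
    Relation.TransGen (IsParent G pp) P P' := by
  induction hn : tightRank G P - tightRank G P' using Nat.strong_induction_on
    generalizing P P' with
  | _ n ih =>
  by_cases hpar : IsParent G pp P P'
  · exact .single hpar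
  · rw [IsParent, and_iff_right h, not_not] at hpar
    obtain ⟨Q, -, h1, h2⟩ := hpar
    have := h1.tightRank_lt hG hp
    have := h2.tightRank_lt hG hp
    exact (ih _ (by omega) h1 rfl).trans (ih _ (by omega) h2 rfl)

theorem agrees_isParent_iff [Nontrivial V] (hG : G.Connected) (hp : IsPrimePartition G pp)
    {x : G.edgeSet → ℝ} : Agrees G pp (IsParent G pp) x ↔ Agrees G pp (LeadsTo G pp) x := by
  constructor
  · rintro ⟨hle, hR, hD⟩
    refine ⟨hle, fun P _ P' _ h => ?_, hD⟩
    have := h.transGen_isParent hG hp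
    clear h
    induction this with
    | single h => exact hR _ h.1.1 _ h.1.2.1 h
    | @tail Q Q' _ h ih =>
      intro e he e' he'
      obtain ⟨f, hf⟩ := pp.nonempty_of_mem_parts (mem_parts_of_nondegenerate h.1.1)
      exact (hR _ h.1.1 _ h.1.2.1 h f hf e' he').trans (ih h.1.1 e he f hf)
  · rintro ⟨hle, hR, hD⟩
    exact ⟨hle, fun P hP P' hP' h => hR P hP P' hP' h.1, hD⟩

/-! ### The explicit system of inequalities. -/

theorem mem_parentChildPairs {p : Finset G.edgeSet × Finset G.edgeSet} :
    p ∈ parentChildPairs G pp ↔ IsParent G pp p.1 p.2 := by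
  simp only [parentChildPairs, Finset.mem_filter, Finset.mem_product, and_iff_right_iff_imp]
  exact fun h => ⟨mem_parts_of_nondegenerate h.1.1, mem_parts_of_nondegenerate h.1.2.1⟩

theorem sum_card_nondegenerateParts_le [Nontrivial V] (hG : G.Connected)
    (hp : IsPrimePartition G pp) :
    ∑ P ∈ nondegenerateParts G pp, P.card + (degenerateSet G pp).card ≤
      Fintype.card G.edgeSet := by
  have hdisj : Disjoint ((nondegenerateParts G pp).biUnion id) (degenerateSet G pp) := by
    rw [Finset.disjoint_biUnion_left]
    intro P hP
    rw [Finset.disjoint_left]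
    exact fun e he =>
      (hp.mem_nondegenerateParts_iff hG (mem_parts_of_nondegenerate hP) he).1 hP
  have h1 : ∑ P ∈ nondegenerateParts G pp, P.card =
      ((nondegenerateParts G pp).biUnion id).card := by
    rw [Finset.card_biUnion]
    · rfl
    · exact fun P hP Q hQ h =>
        pp.disjoint (mem_parts_of_nondegenerate hP) (mem_parts_of_nondegenerate hQ) h
  rw [h1, ← Finset.card_union_of_disjoint hdisj]
  exact Finset.card_le_univ _

/-- A cyclic system of inequalities along each element of a family of edge sets forces equality
on each of them. -/
theorem exists_cyclic_system (s : Finset (Finset G.edgeSet)) :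
    ∃ A : Finset (G.edgeSet × G.edgeSet), (∀ p ∈ A, ∃ P ∈ s, p.1 ∈ P ∧ p.2 ∈ P) ∧
      A.card ≤ ∑ P ∈ s, P.card ∧ ∀ x : G.edgeSet → ℝ, (∀ p ∈ A, x p.2 ≤ x p.1) →
        ∀ P ∈ s, ∀ e ∈ P, ∀ f ∈ P, x e = x f := by
  classical
  -- A cyclic permutation of each element gives one inequality per edge; following the cycle yields
  -- both directions between any two edges.
  choose σ hσ _ using fun P : Finset G.edgeSet => P.exists_cycleOn
  refine ⟨s.biUnion fun P => P.image fun e => (e, σ P e), ?_, ?_, ?_⟩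
  · intro p hmem
    simp only [Finset.mem_biUnion, Finset.mem_image] at hmem
    obtain ⟨P, hP, e, he, rfl⟩ := hmem
    exact ⟨P, hP, he, (hσ P).1.mapsTo he⟩
  · exact Finset.card_biUnion_le.trans (Finset.sum_le_sum fun P _ => Finset.card_image_le)
  · intro x hx P hP
    have hle : ∀ e ∈ P, ∀ f ∈ P, x f ≤ x e := fun e he f hf => by
      obtain ⟨n, -, rfl⟩ := (hσ P).exists_pow_eq he hf
      clear hf
      induction n with
      | zero => simp
      | succ n ih =>
        refine le_trans ?_ ih
        rw [pow_succ', Equiv.Perm.mul_apply]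
        refine hx ((σ P ^ n) e, _) (Finset.mem_biUnion.2 ⟨P, hP, Finset.mem_image.2 ⟨_, ?_, rfl⟩⟩)
        exact ((hσ P).1.perm_pow n).mapsTo he
    exact fun e he f hf => le_antisymm (hle f hf e he) (hle e he f hf)

/-- One inequality for each parent–child pair. -/
theorem exists_parent_child_system (pp : Finpartition (Finset.univ : Finset G.edgeSet)) :
    ∃ B : Finset (G.edgeSet × G.edgeSet),
      (∀ p ∈ B, ∃ P P', IsParent G pp P P' ∧ p.1 ∈ P ∧ p.2 ∈ P') ∧
      B.card = (parentChildPairs G pp).card ∧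
      ∀ P P', IsParent G pp P P' → ∃ p ∈ B, p.1 ∈ P ∧ p.2 ∈ P' := by
  classical
  have hne : ∀ P : pp.parts, ∃ e, e ∈ P.1 := fun P => pp.nonempty_of_mem_parts P.2
  choose r hr using hne
  have hrep : ∀ p : parentChildPairs G pp, ∃ q : G.edgeSet × G.edgeSet,
      q.1 ∈ p.1.1 ∧ q.2 ∈ p.1.2 := fun p => by
    have h := (mem_parentChildPairs.1 p.2).1
    exact ⟨(r ⟨_, mem_parts_of_nondegenerate h.1⟩, r ⟨_, mem_parts_of_nondegenerate h.2.1⟩),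
      hr _, hr _⟩
  choose q hq using hrep
  refine ⟨Finset.univ.image q, ?_, ?_, ?_⟩
  · intro p hmem
    simp only [Finset.mem_image, Finset.mem_univ, true_and] at hmem
    obtain ⟨p, rfl⟩ := hmem
    exact ⟨p.1.1, p.1.2, mem_parentChildPairs.1 p.2, hq p⟩
  -- Elements of the partition are disjoint, so the two chosen edges determine the pair and the
  -- count is exact.
  · rw [Finset.card_image_of_injective, Finset.card_univ, Fintype.card_coe]
    intro p p' h
    have hm := (mem_parentChildPairs.1 p.2).1
    have hm' := (mem_parentChildPairs.1 p'.2).1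
    have h1 := hq p'
    rw [← h] at h1
    exact Subtype.ext (Prod.ext
      (pp.eq_of_mem_parts (mem_parts_of_nondegenerate hm.1) (mem_parts_of_nondegenerate hm'.1)
        (hq p).1 h1.1)
      (pp.eq_of_mem_parts (mem_parts_of_nondegenerate hm.2.1) (mem_parts_of_nondegenerate hm'.2.1)
        (hq p).2 h1.2))
  · exact fun P P' h => ⟨q ⟨(P, P'), mem_parentChildPairs.2 h⟩,
      Finset.mem_image_of_mem _ (Finset.mem_univ _), hq _⟩

end Wiretap

theorem mainTheorem4 {V : Type*} [Fintype V] [DecidableEq V] [Nontrivial V]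
    (G : SimpleGraph V) [DecidableRel G.Adj] (hG : G.Connected) :
    (∃! pp : Finpartition (Finset.univ : Finset G.edgeSet), Wiretap.IsPrimePartition G pp) ∧
    ∀ pp : Finpartition (Finset.univ : Finset G.edgeSet), Wiretap.IsPrimePartition G pp →
      (∀ x ∈ Wiretap.EdgeDist G,
        (Wiretap.IsMaxmin G x ↔ Wiretap.Agrees G pp (Wiretap.LeadsTo G pp) x)) ∧
      (∀ x ∈ Wiretap.EdgeDist G,
        (Wiretap.IsMaxmin G x ↔ Wiretap.Agrees G pp (Wiretap.IsParent G pp) x)) ∧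
      (∃ A B : Finset (G.edgeSet × G.edgeSet),
        (∀ p ∈ A, ∃ P ∈ Wiretap.nondegenerateParts G pp, p.1 ∈ P ∧ p.2 ∈ P) ∧
        (∀ p ∈ B, ∃ P P', Wiretap.IsParent G pp P P' ∧ p.1 ∈ P ∧ p.2 ∈ P') ∧
        A.card + (Wiretap.degenerateSet G pp).card ≤ Fintype.card G.edgeSet ∧
        B.card = (Wiretap.parentChildPairs G pp).card ∧
        ∀ x ∈ Wiretap.EdgeDist G,
          (Wiretap.IsMaxmin G x ↔
            (∀ e ∈ Wiretap.degenerateSet G pp, x e = 0) ∧ ∀ p ∈ A ∪ B, x p.2 ≤ x p.1)) ∧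
      ∀ P : Finset G.edgeSet, ¬ Relation.TransGen (Wiretap.LeadsTo G pp) P P := by
  obtain ⟨β, hβ, hsep, -⟩ := Wiretap.exists_separating_maxmin hG
  refine ⟨⟨_, Wiretap.isPrimePartition_weightPartition hG hβ hsep, fun qq hq =>
    hq.unique (Wiretap.isPrimePartition_weightPartition hG hβ hsep)⟩, fun pp hp => ?_⟩
  have hparent : ∀ x ∈ Wiretap.EdgeDist G,
      (Wiretap.IsMaxmin G x ↔ Wiretap.Agrees G pp (Wiretap.IsParent G pp) x) := fun x hx => by
    rw [Wiretap.agrees_isParent_iff hG hp, Wiretap.isMaxmin_iff_agrees_leadsTo hG hp hx]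
  refine ⟨fun x hx => Wiretap.isMaxmin_iff_agrees_leadsTo hG hp hx, hparent, ?_,
    Wiretap.not_transGen_leadsTo hG hp⟩
  obtain ⟨A, hA, hAcard, hAx⟩ :=
    Wiretap.exists_cyclic_system (Wiretap.nondegenerateParts G pp)
  obtain ⟨B, hB, hBcard, hBx⟩ := Wiretap.exists_parent_child_system pp
  refine ⟨A, B, hA, hB, (Nat.add_le_add_right hAcard _).trans
    (Wiretap.sum_card_nondegenerateParts_le hG hp), hBcard, fun x hx => ?_⟩
  rw [hparent x hx]
  constructor
  · rintro ⟨hle, hR, hD⟩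
    refine ⟨hD, fun p hmem => ?_⟩
    rcases Finset.mem_union.1 hmem with h | h
    · obtain ⟨P, hP, h1, h2⟩ := hA p h
      exact (Wiretap.le_weightPartition_iff.1 hle P
        (Wiretap.mem_parts_of_nondegenerate hP) _ h2 _ h1).le
    · obtain ⟨P, P', hPP', h1, h2⟩ := hB p h
      exact hR P hPP'.1.1 P' hPP'.1.2.1 hPP' _ h1 _ h2
  · rintro ⟨hD, hAB⟩
    have hconst := hAx x fun p h => hAB p (Finset.mem_union_left _ h)
    refine ⟨Wiretap.le_weightPartition_iff.2 fun P hP e he f hf => ?_,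
      fun P hP P' hP' h e he e' he' => ?_, hD⟩
    -- The inequalities in `A` do not touch D; there constancy comes from the equations.
    · by_cases hPn : P ∈ Wiretap.nondegenerateParts G pp
      · exact hconst P hPn e he f hf
      · have hmem : ∀ a ∈ P, a ∈ Wiretap.degenerateSet G pp := fun a ha => by
          by_contra h
          exact hPn ((hp.mem_nondegenerateParts_iff hG hP ha).2 h)
        rw [hD e (hmem e he), hD f (hmem f hf)]
    · obtain ⟨p, hpB, h1, h2⟩ := hBx P P' h
      rw [hconst P hP e he p.1 h1, hconst P' hP' e' he' p.2 h2]
      exact hAB p (Finset.mem_union_right _ hpB)
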